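/- Let $\Lambda$ be a finite dimensional algebra over a field $k$. Write $\Lambda\text{-}\mathrm{Mod}$ for the category of left $\Lambda$-modules and $\Lambda\text{-}\mathrm{mod}$ for its full subcategory of finitely presented modules. For a class $\mathcal{C}$ of modules put ${}^{\perp_0}\mathcal{C}=\{M\in\Lambda\text{-}\mathrm{Mod} : \mathrm{Hom}(M,C)=0 \text{ for all } C\in\mathcal{C}\}$ and $\mathcal{C}^{\perp_0}=\{M\in\Lambda\text{-}\mathrm{Mod} : \mathrm{Hom}(C,M)=0 \text{ for all } C\in\mathcal{C}\}$. A torsion pair in $\Lambda\text{-}\mathrm{Mod}$ (resp. $\Lambda\text{-}\mathrm{mod}$) is a pair $(\mathcal{T},\mathcal{F})$ of isomorphism-closed classes of objects of that category such that $\mathrm{Hom}(T,F)=0$ for all $T\in\mathcal{T}$, $F\in\mathcal{F}$, and every object $X$ has a short exact sequence $0\to T\to X\to F\to 0$ with $T\in\mathcal{T}$, $F\in\mathcal{F}$. A short exact sequence $0\to L\to M\to N\to 0$ in $\Lambda\text{-}\mathrm{Mod}$ is pure if $0\to\mathrm{Hom}(U,L)\to\mathrm{Hom}(U,M)\to\mathrm{Hom}(U,N)\to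 0$ is exact for every $U\in\Lambda\text{-}\mathrm{mod}$; then $L$ is called a pure submodule of $M$. A class of modules is definable if it is closed under products, pure submodules and direct limits. **Theorem.** There is a bijection between torsion pairs in $\Lambda\text{-}\mathrm{mod}$ and torsion pairs $(\mathcal{T},\mathcal{F})$ in $\Lambda\text{-}\mathrm{Mod}$ whose torsion class $\mathcal{T}$ is definable. It sends a torsion pair $(\mathbf{t},\mathbf{f})$ in $\Lambda\text{-}\mathrm{mod}$ to $(\mathcal{T},\mathcal{F})=\bigl({}^{\perp_0}\mathbf{f},\,({}^{\perp_0}\mathbf{f})^{\perp_0}\bigr)$, and here $\mathcal{T}$ is also the class of all modules isomorphic to a pure submodule of a direct product of a (set-indexed) family of modules in $\mathbf{t}$. The inverse sends $(\mathcal{T},\mathcal{F})$ to its restriction $(\mathcal{T}\cap\Lambda\text{-}\mathrm{mod},\,\mathcal{F}\cap\Lambda\text{-}\mathrm{mod})$. -/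

import Mathlib

open CategoryTheory

universe u v

/-- The class `R-mod` of finitely presented left `R`-modules, inside `R-Mod`. -/
def fpModules (R : Type u) [Ring R] : ObjectProperty (ModuleCat.{u} R) :=
  fun M => Module.FinitePresentation R M

/-- A torsion pair in the full subcategory of `R-Mod` given by the class `A`
(used for `A = ⊤`, i.e. `R-Mod`, and for `A = fpModules R`, i.e. `R-mod`):
two isomorphism-closed classes `tors`, `torsFree` of objects of `A`, with no nonzero map from the
first to the second, such that each `X` in `A` has a short exact sequence
`0 → N → X → X ⧸ N → 0` with `N` in `tors` and `X ⧸ N` in `torsFree`. -/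
@[ext]
structure TorsionPairIn {R : Type u} [Ring R] (A : ObjectProperty (ModuleCat.{u} R)) where
  tors : ObjectProperty (ModuleCat.{u} R)
  torsFree : ObjectProperty (ModuleCat.{u} R)
  tors_le : tors ≤ A
  torsFree_le : torsFree ≤ A
  tors_iso : tors.IsClosedUnderIsomorphisms
  torsFree_iso : torsFree.IsClosedUnderIsomorphisms
  hom_eq_zero : ∀ X Y : ModuleCat.{u} R, tors X → torsFree Y → ∀ f : X ⟶ Y, f = 0
  exists_sequence : ∀ X : ModuleCat.{u} R, A X →
    ∃ N : Submodule R X, tors (ModuleCat.of R N) ∧ torsFree (ModuleCat.of R (X ⧸ N))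

/-- The sequence `0 → L → M → N → 0` is exact, and for every finitely presented `U` the sequence
`0 → Hom(U, L) → Hom(U, M) → Hom(U, N) → 0` is exact. -/
def IsPureExact {R : Type u} [Ring R] {L M N : Type u}
    [AddCommGroup L] [Module R L] [AddCommGroup M] [Module R M] [AddCommGroup N] [Module R N]
    (f : L →ₗ[R] M) (g : M →ₗ[R] N) : Prop :=
  (Function.Injective f ∧ Function.Exact f g ∧ Function.Surjective g) ∧
  ∀ U : ModuleCat.{u} R, fpModules R U →
    Function.Injective (fun a : U →ₗ[R] L => f ∘ₗ a) ∧
    Function.Exact (fun a : U →ₗ[R] L => f ∘ₗ a) (fun b : U →ₗ[R] M => g ∘ₗ b) ∧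
    Function.Surjective (fun b : U →ₗ[R] M => g ∘ₗ b)

/-- `f : L → M` embeds `L` as a pure submodule of `M`. -/
def IsPureEmbedding {R : Type u} [Ring R] {L M : Type u}
    [AddCommGroup L] [Module R L] [AddCommGroup M] [Module R M] (f : L →ₗ[R] M) : Prop :=
  IsPureExact f (LinearMap.range f).mkQ

/-- A class of modules is definable if it is closed under products, pure submodules and
direct limits (of directed systems indexed by nonempty directed preorders). -/
structure IsDefinable {R : Type u} [Ring R] (D : ObjectProperty (ModuleCat.{u} R)) : Prop where
  product : ∀ (ι : Type u) (M : ι → ModuleCat.{u} R), (∀ i, D (M i)) →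
    D (ModuleCat.of R (∀ i, M i))
  pureSub : ∀ (L M : ModuleCat.{u} R) (f : L →ₗ[R] M), IsPureEmbedding f → D M → D L
  directLimit : ∀ (ι : Type u) [DecidableEq ι] [Preorder ι] [IsDirectedOrder ι] [Nonempty ι]
    (G : ι → ModuleCat.{u} R) (f : ∀ i j, i ≤ j → G i →ₗ[R] G j)
    [DirectedSystem (fun i => G i) (fun i j h => f i j h)], (∀ i, D (G i)) →
    D (ModuleCat.of R (Module.DirectLimit (fun i => G i) f))

/-- The class of modules that are (isomorphic to) pure submodules of products of (set-indexed)
families of modules in `C`. -/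
def pureCogen {R : Type u} [Ring R] (C : ObjectProperty (ModuleCat.{u} R)) :
    ObjectProperty (ModuleCat.{u} R) :=
  fun X => ∃ (ι : Type u) (M : ι → ModuleCat.{u} R), (∀ i, C (M i)) ∧
    ∃ f : X →ₗ[R] (∀ i, M i), IsPureEmbedding f

/-! Purity is solvability of finite linear systems: `f : L → M` is pure iff every system with
constants in `L` that is solvable in `M` is solvable in `L`. Two consequences of `k`-duality carry
the theorem. First, for `F` finite dimensional, `Hom(M, F)` is dual to `DF ⊗ M`, so `Hom(M, F) = 0`
says that one fixed system is solvable in `M` for all constants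
(`exists_hasLinearSolution_iff_forall_hom_eq_zero`); this passes to products and pure submodules, so
the left orthogonal of `𝐟` is definable. Second, every module is pure in the product of its finite
dimensional quotients (`hasLinearSolution_of_forall_finite_quotient`).

If `M` is left orthogonal to `𝐟`, so are its finite dimensional quotients, which therefore lie in
`𝐭`; hence the left orthogonal is `pureCogen 𝐭`. A definable torsion class contains `pureCogen` of
its finitely presented part, so it is recovered from that part. -/

/-- The system of linear equations `∑ i, a i j • y i = x j` has a solution `y` in `M`. -/
def HasLinearSolution {R : Type*} [Ring R] {M : Type*} [AddCommGroup M] [Module R M] {n m : ℕ}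
    (a : Fin n → Fin m → R) (x : Fin m → M) : Prop :=
  ∃ y : Fin n → M, ∀ j, ∑ i, a i j • y i = x j

/-! ### Purity and linear systems -/

section Purity

variable {R : Type u} [Ring R]

lemma HasLinearSolution.map {M N : Type*} [AddCommGroup M] [Module R M] [AddCommGroup N] [Module R N]
    {n m : ℕ} {a : Fin n → Fin m → R} {x : Fin m → M} (h : HasLinearSolution a x) (f : M →ₗ[R] N) :
    HasLinearSolution a (fun j => f (x j)) := by
  obtain ⟨y, hy⟩ := h
  exact ⟨fun i => f (y i), fun j => by simp [← hy j]⟩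

variable {L M : Type u} [AddCommGroup L] [Module R L] [AddCommGroup M] [Module R M]

/-- The rows of `a` present a module `U`. A solution in `M` induces `U → M / f(L)`; a lift `U → M`
differs from the solution by elements of `f(L)`, and these differences solve the system in `L`. -/
lemma IsPureEmbedding.hasLinearSolution {f : L →ₗ[R] M} (hf : IsPureEmbedding f) {n m : ℕ}
    {a : Fin n → Fin m → R} {x : Fin m → L} (h : HasLinearSolution a (fun j => f (x j))) :
    HasLinearSolution a x := by
  obtain ⟨y, hy⟩ := h
  obtain ⟨⟨hinj, hex, -⟩, hU⟩ := hf
  let r : Fin m → Fin n → R := fun j i => a i j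
  let K : Submodule R (Fin n → R) := Submodule.span R (Set.range r)
  have hfp : Module.FinitePresentation R ((Fin n → R) ⧸ K) := by
    refine Module.finitePresentation_of_surjective K.mkQ K.mkQ_surjective ?_
    rw [Submodule.ker_mkQ]
    exact Submodule.fg_span (Set.finite_range r)
  let φ : (Fin n → R) →ₗ[R] M := Fintype.linearCombination R y
  have hφ (j) : φ (r j) = f (x j) := by
    simp [φ, r, Fintype.linearCombination_apply, hy]
  have hK : K ≤ LinearMap.ker ((LinearMap.range f).mkQ ∘ₗ φ) := by
    rw [Submodule.span_le]
    rintro _ ⟨j, rfl⟩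
    simp [hφ]
  obtain ⟨h, hh⟩ := (hU (ModuleCat.of R ((Fin n → R) ⧸ K)) hfp).2.2
    (K.liftQ ((LinearMap.range f).mkQ ∘ₗ φ) hK)
  replace hh : (LinearMap.range f).mkQ ∘ₗ h = K.liftQ ((LinearMap.range f).mkQ ∘ₗ φ) hK := hh
  have key (c : Fin n → R) : φ c - h (K.mkQ c) ∈ LinearMap.range f := by
    have := LinearMap.congr_fun hh (K.mkQ c)
    simp only [LinearMap.comp_apply, Submodule.mkQ_apply, Submodule.liftQ_apply] at this
    exact (Submodule.Quotient.eq _).1 this.symm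
  choose z hz using fun i => key (Pi.single i 1)
  refine ⟨z, fun j => hinj ?_⟩
  have h0 : K.mkQ (r j) = 0 := by
    simpa using Submodule.subset_span (Set.mem_range_self j)
  have hr : ∑ i, a i j • (Pi.single i 1 : Fin n → R) = r j := by
    ext i
    simp [r, Finset.sum_apply, Pi.single_apply]
  calc f (∑ i, a i j • z i)
      = ∑ i, a i j • (φ (Pi.single i 1) - h (K.mkQ (Pi.single i 1))) := by
        simp only [map_sum, map_smul, hz]
    _ = φ (∑ i, a i j • Pi.single i 1) - h (K.mkQ (∑ i, a i j • Pi.single i 1)) := by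
        simp only [map_sum, map_smul, smul_sub, Finset.sum_sub_distrib]
    _ = f (x j) := by rw [hr, h0, map_zero, sub_zero, hφ]

/-- Lift a map `U → M / f(L)` on the generators of `U`. The relations of `U` are then sent into
`f(L)`, and solving the resulting system in `L` corrects the lift. -/
lemma isPureEmbedding_of_hasLinearSolution {f : L →ₗ[R] M}
    (H : ∀ (n m : ℕ) (a : Fin n → Fin m → R) (x : Fin m → L),
      HasLinearSolution a (fun j => f (x j)) → HasLinearSolution a x) : IsPureEmbedding f := by
  have hinj : Function.Injective f := by
    rw [injective_iff_map_eq_zero]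
    intro x hx
    -- With no unknowns, the one equation reads `0 = x`.
    obtain ⟨y, hy⟩ := H 0 1 (fun _ _ => 0) (fun _ => x) ⟨fun _ => 0, fun j => by simp [hx]⟩
    simpa using (hy 0).symm
  have hex : Function.Exact f (LinearMap.range f).mkQ := by
    rw [LinearMap.exact_iff, Submodule.ker_mkQ]
  refine ⟨⟨hinj, hex, Submodule.mkQ_surjective _⟩, fun U hU => ⟨?_, ?_, ?_⟩⟩
  · intro a b hab
    exact LinearMap.ext fun u => hinj (LinearMap.congr_fun hab u)
  · intro b
    constructor
    · intro hb
      have hb' (u : U) : ∃ l, f l = b u := by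
        have := LinearMap.congr_fun hb u
        exact (hex _).1 this
      choose s hs using hb'
      refine ⟨⟨⟨s, fun u v => hinj ?_⟩, fun c u => hinj ?_⟩, ?_⟩
      · simp [hs]
      · simp [hs]
      · exact LinearMap.ext fun u => hs u
    · rintro ⟨a, rfl⟩
      exact LinearMap.ext fun u => (hex _).2 ⟨a u, rfl⟩
  · intro g
    have : Module.FinitePresentation R U := hU
    obtain ⟨n, m, p, q, hp, hqp⟩ := Module.FinitePresentation.exists_fin' R U
    have hlift (i : Fin n) : ∃ y : M, (LinearMap.range f).mkQ y = g (p (Pi.single i 1)) :=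
      Submodule.mkQ_surjective _ _
    choose y hy using hlift
    let φ : (Fin n → R) →ₗ[R] M := Fintype.linearCombination R y
    have hφ : (LinearMap.range f).mkQ ∘ₗ φ = g ∘ₗ p := by
      refine LinearMap.pi_ext' fun i => LinearMap.ext_ring ?_
      simpa [φ, Fintype.linearCombination_apply_single] using hy i
    have hr (j : Fin m) : ∃ x : L, f x = φ (q (Pi.single j 1)) := by
      refine (hex _).1 ?_
      have := LinearMap.congr_fun hφ (q (Pi.single j 1))
      rw [LinearMap.comp_apply, LinearMap.comp_apply, hqp.apply_apply_eq_zero, map_zero] at this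
      exact this
    choose x hx using hr
    obtain ⟨z, hz⟩ := H n m (fun i j => q (Pi.single j 1) i) x
      ⟨y, fun j => by simp only [hx, φ, Fintype.linearCombination_apply]⟩
    let ψ : (Fin n → R) →ₗ[R] M := φ - f ∘ₗ Fintype.linearCombination R z
    have hψ : ψ ∘ₗ q = 0 := by
      refine LinearMap.pi_ext' fun j => LinearMap.ext_ring ?_
      have : Fintype.linearCombination R z (q (Pi.single j 1)) = x j := by
        rw [Fintype.linearCombination_apply, hz]
      simp [ψ, this, hx]
    have hker : LinearMap.ker p ≤ LinearMap.ker ψ := by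
      intro c hc
      obtain ⟨d, rfl⟩ := (hqp c).1 hc
      exact LinearMap.congr_fun hψ d
    let e := p.quotKerEquivOfSurjective hp
    refine ⟨(LinearMap.ker p).liftQ ψ hker ∘ₗ e.symm.toLinearMap, LinearMap.ext fun u => ?_⟩
    obtain ⟨c, rfl⟩ := hp u
    have he : e.symm (p c) = (LinearMap.ker p).mkQ c := by
      rw [LinearEquiv.symm_apply_eq]
      rfl
    have h2 : (LinearMap.range f).mkQ (f (Fintype.linearCombination R z c)) = 0 :=
      hex.apply_apply_eq_zero _
    have h3 := LinearMap.congr_fun hφ c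
    change (LinearMap.range f).mkQ ((LinearMap.ker p).liftQ ψ hker (e.symm (p c))) = g (p c)
    have h4 : (LinearMap.ker p).liftQ ψ hker ((LinearMap.ker p).mkQ c) =
      φ c - f (Fintype.linearCombination R z c) := Submodule.liftQ_apply _ _ _
    rw [he, h4, map_sub, h2, sub_zero]
    exact h3

end Purity

/-! ### Duality over the base field -/

section Duality

variable {k : Type v} [Field k] {Λ : Type u} [Ring Λ] [Algebra k Λ]

lemma exists_dual_of_not_hasLinearSolution {M : Type*} [AddCommGroup M] [Module k M] [Module Λ M]
    [IsScalarTower k Λ M] {n m : ℕ} {a : Fin n → Fin m → Λ} {x : Fin m → M}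
    (hx : ¬ HasLinearSolution a x) :
    ∃ ψ : (Fin m → M) →ₗ[k] k, ψ x ≠ 0 ∧ ∀ y : Fin n → M, ψ (fun j => ∑ i, a i j • y i) = 0 := by
  let A : (Fin n → M) →ₗ[k] (Fin m → M) :=
    LinearMap.pi fun j => ∑ i, (Algebra.lsmul k k M (a i j)) ∘ₗ LinearMap.proj i
  have hA (y) : A y = fun j => ∑ i, a i j • y i := by ext j; simp [A]
  have hxA : x ∉ LinearMap.range A := by
    rintro ⟨y, hy⟩
    exact hx ⟨y, fun j => by rw [← hy, hA]⟩
  obtain ⟨ψ, hψx, hψ⟩ := Submodule.exists_le_ker_of_notMem hxA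
  exact ⟨ψ, hψx, fun y => by rw [← hA]; exact hψ ⟨y, rfl⟩⟩

variable (k) in
lemma hasLinearSolution_of_forall_finite_quotient [FiniteDimensional k Λ] {M : Type*}
    [AddCommGroup M] [Module Λ M] {n m : ℕ} {a : Fin n → Fin m → Λ} {x : Fin m → M}
    (H : ∀ N : Submodule Λ M, Module.Finite Λ (M ⧸ N) →
      HasLinearSolution a (fun j => N.mkQ (x j))) :
    HasLinearSolution a x := by
  let _ : Module k M := Module.compHom M (algebraMap k Λ)
  have : IsScalarTower k Λ M := IsScalarTower.of_algebraMap_smul fun _ _ => rfl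
  by_contra hx
  obtain ⟨ψ, hψx, hψ⟩ := exists_dual_of_not_hasLinearSolution (k := k) hx
  let E : M →ₗ[k] (Λ →ₗ[k] (Fin m → k)) :=
    LinearMap.mk₂ k (fun y l j => ψ (Pi.single j (l • y)))
      (fun y z l => by ext j; simp [smul_add, Pi.single_add])
      (fun c y l => by ext j; simp [smul_comm l c y, Pi.single_smul])
      (fun y l l' => by ext j; simp [add_smul, Pi.single_add])
      (fun c y l => by ext j; simp [Pi.single_smul])
  have hE (y l j) : E y l j = ψ (Pi.single j (l • y)) := rfl
  -- The largest `Λ`-submodule on which all coordinates of `ψ` vanish. Since `M ⧸ N` embeds in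
  -- `Hom_k(Λ, k^m)`, it is finite dimensional, and a solution modulo `N` forces `ψ x = 0`.
  let N : Submodule Λ M :=
    { carrier := {y | E y = 0}
      add_mem' := fun {y z} hy hz => by
        simp only [Set.mem_ofPred_eq] at hy hz ⊢
        rw [map_add, hy, hz, add_zero]
      zero_mem' := map_zero E
      smul_mem' := fun c y hy => by
        simp only [Set.mem_ofPred_eq] at hy ⊢
        ext l j
        rw [hE, smul_smul, ← hE, hy]
        rfl }
  have hker : N.restrictScalars k = LinearMap.ker E := rfl
  let Ebar : (M ⧸ N) →ₗ[k] (Λ →ₗ[k] (Fin m → k)) :=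
    (N.restrictScalars k).liftQ E hker.le ∘ₗ
      (Submodule.Quotient.restrictScalarsEquiv k N).symm.toLinearMap
  have hEbar : Function.Injective Ebar := by
    refine Function.Injective.comp (g := (N.restrictScalars k).liftQ E hker.le) ?_
      (Submodule.Quotient.restrictScalarsEquiv k N).symm.injective
    rw [← LinearMap.ker_eq_bot]
    exact Submodule.ker_liftQ_eq_bot _ _ _ hker.ge
  have : Module.Finite k (M ⧸ N) := Module.Finite.of_injective Ebar hEbar
  obtain ⟨y, hy⟩ := H N (Module.Finite.of_restrictScalars_finite k Λ _)
  choose z hz using fun i => N.mkQ_surjective (y i)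
  have hN (j) : ∑ i, a i j • z i - x j ∈ N := by
    rw [← Submodule.Quotient.eq, ← Submodule.mkQ_apply, ← Submodule.mkQ_apply]
    simp only [← hy j, map_sum, map_smul, hz]
  have h0 : ψ ((fun j => ∑ i, a i j • z i) - x) = 0 := by
    rw [← Finset.univ_sum_single ((fun j => ∑ i, a i j • z i) - x), map_sum]
    refine Finset.sum_eq_zero fun j _ => ?_
    have := congr_fun (LinearMap.congr_fun (show E _ = 0 from hN j) 1) j
    rw [hE, one_smul] at this
    exact this
  rw [map_sub, hψ, zero_sub, neg_eq_zero] at h0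
  exact hψx h0

variable (k) in
-- The dual basis gives a surjection `T : Λ^d → DF`. Generators `r` of its kernel present `DF`, so
-- the system is solvable for all `x` iff `DF ⊗ M = 0`.
lemma exists_hasLinearSolution_iff_forall_hom_eq_zero [FiniteDimensional k Λ]
    (F : Type*) [AddCommGroup F] [Module Λ F] [Module.Finite Λ F] :
    ∃ (n m : ℕ) (a : Fin n → Fin m → Λ), ∀ (M : Type u) [AddCommGroup M] [Module Λ M],
      (∀ g : M →ₗ[Λ] F, g = 0) ↔ ∀ x : Fin m → M, HasLinearSolution a x := by
  let _ : Module k F := Module.compHom F (algebraMap k Λ)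
  have : IsScalarTower k Λ F := IsScalarTower.of_algebraMap_smul fun _ _ => rfl
  have : Module.Finite k F := Module.Finite.trans Λ F
  let b := Module.finBasis k F
  let T : (Fin (Module.finrank k F) → Λ) →ₗ[k] Module.Dual k F :=
    LinearMap.mk₂ k (fun c v => ∑ j, b.coord j (c j • v))
      (fun c c' v => by simp [add_smul, Finset.sum_add_distrib])
      (fun s c v => by simp [Finset.mul_sum])
      (fun c v w => by simp [smul_add, Finset.sum_add_distrib])
      (fun s c v => by simp [smul_comm _ s v, Finset.mul_sum])
  have hT (c v) : T c v = ∑ j, b.coord j (c j • v) := rfl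
  obtain ⟨n, r, hr⟩ := Submodule.fg_iff_exists_fin_generating_family.1
    (IsNoetherian.noetherian (LinearMap.ker T))
  refine ⟨n, _, r, fun M _ _ => ⟨fun H x => ?_, fun H g => ?_⟩⟩
  · let _ : Module k M := Module.compHom M (algebraMap k Λ)
    have : IsScalarTower k Λ M := IsScalarTower.of_algebraMap_smul fun _ _ => rfl
    by_contra hx
    obtain ⟨ψ, hψx, hψ⟩ := exists_dual_of_not_hasLinearSolution (k := k) hx
    have hψK (y : M) (c) (hc : c ∈ LinearMap.ker T) : ψ (fun j => c j • y) = 0 := by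
      rw [← hr] at hc
      induction hc using Submodule.span_induction with
      | mem c hc =>
        obtain ⟨i, rfl⟩ := hc
        rw [← hψ (Pi.single i y)]
        congr 1
        ext j
        rw [Finset.sum_eq_single i (fun l _ hl => by simp [hl]) (by simp), Pi.single_eq_same]
      | zero =>
        rw [← map_zero ψ]
        congr 1
        ext j
        simp
      | add c c' _ _ hc hc' =>
        rw [← add_zero (0 : k)]
        nth_rewrite 1 [← hc]
        rw [← hc', ← map_add]
        congr 1
        ext j
        simp [add_smul]
      | smul s c _ hc =>
        rw [← smul_zero s, ← hc, ← map_smul]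
        congr 1
        ext j
        simp
    -- The map corresponding to `ψ` as a functional on `DF ⊗ M`.
    let g₀ : M → F := fun y => ∑ j, ψ (Pi.single j y) • b j
    have hcoord (y i) : b.coord i (g₀ y) = ψ (Pi.single i y) := by
      simp [g₀, Finsupp.single_apply]
    have key (c y) : T c (g₀ y) = ψ (fun j => c j • y) := by
      -- The dual basis spans `DF` over `k`, so modulo `ker T` every `c` has scalar entries.
      let c' : Fin (Module.finrank k F) → Λ := fun i => algebraMap k Λ (T c (b i))
      have hc' : T c' = T c := by
        refine b.ext fun l => ?_
        rw [hT]
        simp [c', algebraMap_smul, Finsupp.single_apply]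
      have h1 := hψK y (c - c') (by rw [LinearMap.mem_ker, map_sub, hc', sub_self])
      have h2 : (fun j => (c - c') j • y) = (fun j => c j • y) - fun j => c' j • y := by
        ext j
        simp [sub_smul]
      rw [h2, map_sub, sub_eq_zero] at h1
      rw [h1, ← Finset.univ_sum_single (fun j => c' j • y)]
      simp [g₀, c', algebraMap_smul, Pi.single_smul, mul_comm]
    let g : M →ₗ[Λ] F :=
      { toFun := g₀
        map_add' := fun y z => by simp [g₀, Pi.single_add, add_smul, Finset.sum_add_distrib]
        map_smul' := fun s y => b.ext_elem fun i => by
          have h1 : T (Pi.single i s) (g₀ y) = b.coord i (s • g₀ y) := by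
            rw [hT, Finset.sum_eq_single i (fun l _ hl => by simp [hl]) (by simp),
              Pi.single_eq_same]
          have h2 : (fun j => (Pi.single i s : Fin (Module.finrank k F) → Λ) j • y) =
              Pi.single i (s • y) := by
            ext j
            by_cases h : j = i
            · subst h; simp
            · simp [h]
          rw [key, h2, ← hcoord] at h1
          exact h1 }
    apply hψx
    rw [← Finset.univ_sum_single x, map_sum]
    refine Finset.sum_eq_zero fun j _ => ?_
    rw [← hcoord, show g₀ (x j) = 0 from LinearMap.congr_fun (H g) (x j), map_zero]
  · refine LinearMap.ext fun v => b.ext_elem fun j => ?_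
    -- Solvability at this vector makes the `j`-th coordinate of `g v` a sum of values of `T (r i) =
    -- 0`.
    obtain ⟨y, hy⟩ := H (Pi.single j v)
    have h1 : ∑ l, b.coord l (g ((Pi.single j v : Fin _ → M) l)) = b.coord j (g v) := by
      rw [Finset.sum_eq_single j (fun l _ hl => by simp [hl]) (by simp), Pi.single_eq_same]
    have h2 : ∑ l, b.coord l (g ((Pi.single j v : Fin _ → M) l)) = ∑ i, T (r i) (g (y i)) := by
      simp_rw [← hy, hT, map_sum, map_smul]
      exact Finset.sum_comm
    have h3 (i) : T (r i) = 0 := by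
      have := Submodule.subset_span (R := k) (Set.mem_range_self (f := r) i)
      rw [hr] at this
      exact this
    simp only [h3, LinearMap.zero_apply, Finset.sum_const_zero] at h2
    rw [h1] at h2
    simpa using h2

end Duality

/-! ### Orthogonal classes and torsion pairs -/

section Orthogonal

variable {R : Type u} [Ring R]

lemma leftOrthogonal_iff_forall_linearMap {C : ObjectProperty (ModuleCat.{u} R)}
    {M : ModuleCat.{u} R} :
    C.leftOrthogonal M ↔ ∀ Y : ModuleCat.{u} R, C Y → ∀ g : M →ₗ[R] Y, g = 0 :=
  ⟨fun h _ hY g => congrArg ModuleCat.Hom.hom (h (ModuleCat.ofHom g) hY),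
    fun h _ f hY => ModuleCat.hom_ext (h _ hY f.hom)⟩

lemma rightOrthogonal_iff_forall_linearMap {C : ObjectProperty (ModuleCat.{u} R)}
    {M : ModuleCat.{u} R} :
    C.rightOrthogonal M ↔ ∀ Y : ModuleCat.{u} R, C Y → ∀ g : Y →ₗ[R] M, g = 0 :=
  ⟨fun h _ hY g => congrArg ModuleCat.Hom.hom (h (ModuleCat.ofHom g) hY),
    fun h _ f hY => ModuleCat.hom_ext (h _ hY f.hom)⟩

lemma leftOrthogonal_of_surjective {C : ObjectProperty (ModuleCat.{u} R)} {M N : ModuleCat.{u} R}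
    (hM : C.leftOrthogonal M) (p : M →ₗ[R] N) (hp : Function.Surjective p) :
    C.leftOrthogonal N := by
  rw [leftOrthogonal_iff_forall_linearMap] at hM ⊢
  intro Y hY g
  rw [← LinearMap.cancel_right hp, hM Y hY (g ∘ₗ p), LinearMap.zero_comp]

/-- The sum of all left orthogonal submodules is left orthogonal. As the class is closed under
quotients and extensions, the preimage of the image of any map from it to the quotient is again such
a submodule, so that map is zero. -/
lemma exists_leftOrthogonal_submodule (C : ObjectProperty (ModuleCat.{u} R))
    (X : ModuleCat.{u} R) : ∃ N : Submodule R X, C.leftOrthogonal (ModuleCat.of R N) ∧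
      C.leftOrthogonal.rightOrthogonal (ModuleCat.of R (X ⧸ N)) := by
  let S : Set (Submodule R X) := {N | C.leftOrthogonal (ModuleCat.of R N)}
  have hS : C.leftOrthogonal (ModuleCat.of R (sSup S : Submodule R X)) := by
    rw [leftOrthogonal_iff_forall_linearMap]
    intro Y hY g
    have hle : sSup S ≤ (LinearMap.ker g).map (sSup S).subtype := by
      refine sSup_le fun N hN x hx => ?_
      have h0 := leftOrthogonal_iff_forall_linearMap.1 hN Y hY
        (g ∘ₗ Submodule.inclusion (le_sSup hN))
      exact ⟨⟨x, le_sSup hN hx⟩, LinearMap.congr_fun h0 ⟨x, hx⟩, rfl⟩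
    refine LinearMap.ext fun x => ?_
    obtain ⟨x', hx', hxx'⟩ := hle x.2
    rw [← Subtype.ext hxx']
    exact hx'
  refine ⟨sSup S, hS, ?_⟩
  rw [rightOrthogonal_iff_forall_linearMap]
  intro Y hY (h : Y →ₗ[R] (X ⧸ sSup S))
  let N := (LinearMap.range h).comap (sSup S).mkQ
  have hle : sSup S ≤ N := by
    intro x hx
    have : (sSup S).mkQ x = 0 := by simpa using hx
    simp only [N, Submodule.mem_comap, this, zero_mem]
  have hN : N ∈ S := by
    refine leftOrthogonal_iff_forall_linearMap.2 fun F hF g => ?_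
    let π : N →ₗ[R] LinearMap.range h := (sSup S).mkQ.restrict fun x hx => hx
    have hπ : Function.Surjective π := by
      rintro ⟨y, hy⟩
      obtain ⟨x, rfl⟩ := (sSup S).mkQ_surjective y
      exact ⟨⟨x, hy⟩, rfl⟩
    have hker : LinearMap.ker π ≤ LinearMap.ker g := by
      intro x hx
      have hx' : (x : X) ∈ sSup S := by
        rw [← Submodule.ker_mkQ (sSup S)]
        exact congrArg Subtype.val hx
      exact LinearMap.congr_fun (leftOrthogonal_iff_forall_linearMap.1 hS F hF
        (g ∘ₗ Submodule.inclusion hle)) ⟨x, hx'⟩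
    let e := π.quotKerEquivOfSurjective hπ
    have h0 := leftOrthogonal_iff_forall_linearMap.1
      (leftOrthogonal_of_surjective (N := ModuleCat.of R (LinearMap.range h)) hY
        h.rangeRestrict h.surjective_rangeRestrict) F hF
      ((LinearMap.ker π).liftQ g hker ∘ₗ e.symm.toLinearMap)
    refine LinearMap.ext fun x => ?_
    have h1 := LinearMap.congr_fun h0 (π x)
    have he : e.symm (π x) = (LinearMap.ker π).mkQ x := by
      rw [LinearEquiv.symm_apply_eq]
      rfl
    change (LinearMap.ker π).liftQ g hker (e.symm (π x)) = 0 at h1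
    rw [he] at h1
    exact h1
  refine LinearMap.ext fun y => show h y = 0 from ?_
  obtain ⟨x, hx⟩ := (sSup S).mkQ_surjective (h y)
  have hxN : x ∈ N := ⟨y, hx.symm⟩
  have : (sSup S).mkQ x = 0 := by simpa using le_sSup hN hxN
  exact hx.symm.trans this

/-- The torsion pair in `R-Mod` cogenerated by a class of modules. -/
def torsionPairCogeneratedBy (C : ObjectProperty (ModuleCat.{u} R)) :
    TorsionPairIn (⊤ : ObjectProperty (ModuleCat.{u} R)) where
  tors := C.leftOrthogonal
  torsFree := C.leftOrthogonal.rightOrthogonal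
  tors_le := le_top
  torsFree_le := le_top
  tors_iso := inferInstance
  torsFree_iso := inferInstance
  hom_eq_zero _ _ hX hY f := hY f hX
  exists_sequence X _ := exists_leftOrthogonal_submodule C X

namespace TorsionPairIn

variable {A : ObjectProperty (ModuleCat.{u} R)} (p : TorsionPairIn A)

lemma tors_iff (X : ModuleCat.{u} R) : p.tors X ↔ A X ∧ p.torsFree.leftOrthogonal X := by
  refine ⟨fun h => ⟨p.tors_le _ h, fun Y f hY => p.hom_eq_zero X Y h hY f⟩, fun ⟨hA, h⟩ => ?_⟩
  obtain ⟨N, hN, hXN⟩ := p.exists_sequence X hA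
  have h0 := leftOrthogonal_iff_forall_linearMap.1 h _ hXN N.mkQ
  have hN' : N = ⊤ := by rw [← N.ker_mkQ, h0, LinearMap.ker_zero]
  exact p.tors_iso.of_iso (LinearEquiv.toModuleIso (LinearEquiv.ofTop N hN')) hN

lemma torsFree_iff (X : ModuleCat.{u} R) :
    p.torsFree X ↔ A X ∧ p.tors.rightOrthogonal X := by
  refine ⟨fun h => ⟨p.torsFree_le _ h, fun Y f hY => p.hom_eq_zero Y X hY h f⟩,
    fun ⟨hA, h⟩ => ?_⟩
  obtain ⟨N, hN, hXN⟩ := p.exists_sequence X hA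
  have h0 := rightOrthogonal_iff_forall_linearMap.1 h _ hN N.subtype
  have hN' : N = ⊥ := by rw [← N.range_subtype, h0, LinearMap.range_zero]
  exact p.torsFree_iso.of_iso (LinearEquiv.toModuleIso (N.quotEquivOfEqBot hN')) hXN

lemma ext_of_tors_eq {p q : TorsionPairIn A} (h : p.tors = q.tors) : p = q := by
  refine TorsionPairIn.ext h (funext fun X => propext ?_)
  rw [p.torsFree_iff, q.torsFree_iff, h]

end TorsionPairIn

/-- The restriction to `R-mod` of a torsion pair in `R-Mod`, for `R` left noetherian. -/
def TorsionPairIn.restrictFP [IsNoetherianRing R]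
    (P : TorsionPairIn (⊤ : ObjectProperty (ModuleCat.{u} R))) :
    TorsionPairIn (fpModules R) where
  tors := P.tors ⊓ fpModules R
  torsFree := P.torsFree ⊓ fpModules R
  tors_le := inf_le_right
  torsFree_le := inf_le_right
  tors_iso := ⟨fun e ⟨h, h'⟩ => ⟨P.tors_iso.of_iso e h,
    have : Module.FinitePresentation R _ := h'
    Module.FinitePresentation.of_equiv e.toLinearEquiv⟩⟩
  torsFree_iso := ⟨fun e ⟨h, h'⟩ => ⟨P.torsFree_iso.of_iso e h,
    have : Module.FinitePresentation R _ := h'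
    Module.FinitePresentation.of_equiv e.toLinearEquiv⟩⟩
  hom_eq_zero X Y hX hY f := P.hom_eq_zero X Y hX.1 hY.1 f
  exists_sequence X hX := by
    have : Module.FinitePresentation R X := hX
    obtain ⟨N, hN, hXN⟩ := P.exists_sequence X trivial
    exact ⟨N, ⟨hN, Module.finitePresentation_of_finite R N⟩,
      ⟨hXN, Module.finitePresentation_of_finite R (X ⧸ N)⟩⟩

lemma IsDefinable.pureCogen_le {C D : ObjectProperty (ModuleCat.{u} R)} (hD : IsDefinable D)
    (h : C ≤ D) : pureCogen C ≤ D := by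
  rintro X ⟨ι, M, hM, f, hf⟩
  exact hD.pureSub X (ModuleCat.of R (∀ i, M i)) f hf (hD.product ι M fun i => h _ (hM i))

end Orthogonal

/-! ### Definability and the bijection -/

section FiniteDimensional

variable (k : Type v) [Field k] {Λ : Type u} [Ring Λ] [Algebra k Λ] [FiniteDimensional k Λ]

include k

lemma isDefinable_leftOrthogonal {C : ObjectProperty (ModuleCat.{u} Λ)} (hC : C ≤ fpModules Λ) :
    IsDefinable C.leftOrthogonal where
  product ι M hM := by
    refine leftOrthogonal_iff_forall_linearMap.2 fun F hF => ?_
    have : Module.FinitePresentation Λ F := hC _ hF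
    obtain ⟨n, m, a, ha⟩ := exists_hasLinearSolution_iff_forall_hom_eq_zero k (Λ := Λ) F
    refine (ha (∀ i, M i)).2 fun x => ?_
    choose y hy using fun i =>
      (ha (M i)).1 (leftOrthogonal_iff_forall_linearMap.1 (hM i) F hF) fun j => x j i
    refine ⟨fun l i => y i l, fun j => funext fun i => ?_⟩
    rw [Finset.sum_apply]
    exact hy i j
  pureSub L M f hf hM := by
    refine leftOrthogonal_iff_forall_linearMap.2 fun F hF => ?_
    have : Module.FinitePresentation Λ F := hC _ hF
    obtain ⟨n, m, a, ha⟩ := exists_hasLinearSolution_iff_forall_hom_eq_zero k (Λ := Λ) F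
    exact (ha L).2 fun x => hf.hasLinearSolution
      ((ha M).1 (leftOrthogonal_iff_forall_linearMap.1 hM F hF) _)
  directLimit ι _ _ _ _ G f _ hG := by
    refine leftOrthogonal_iff_forall_linearMap.2 fun F hF g => ?_
    refine Module.DirectLimit.hom_ext fun i => ?_
    rw [LinearMap.zero_comp]
    exact leftOrthogonal_iff_forall_linearMap.1 (hG i) F hF _

lemma pureCogen_of_forall_finite_quotient {C : ObjectProperty (ModuleCat.{u} Λ)}
    {M : ModuleCat.{u} Λ} (hM : ∀ N : Submodule Λ M, Module.Finite Λ (M ⧸ N) →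
      C (ModuleCat.of Λ (M ⧸ N))) : pureCogen C M := by
  refine ⟨{N : Submodule Λ M // Module.Finite Λ (M ⧸ N)},
    fun N => ModuleCat.of Λ (M ⧸ N.1), fun N => hM N.1 N.2,
    LinearMap.pi fun N => N.1.mkQ, isPureEmbedding_of_hasLinearSolution fun n m a x h => ?_⟩
  refine hasLinearSolution_of_forall_finite_quotient k fun N hN => ?_
  exact h.map (LinearMap.proj
    (φ := fun N : {N : Submodule Λ M // Module.Finite Λ (M ⧸ N)} => M ⧸ N.1) ⟨N, hN⟩)

lemma TorsionPairIn.leftOrthogonal_torsFree_eq_pureCogen (p : TorsionPairIn (fpModules Λ)) :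
    p.torsFree.leftOrthogonal = pureCogen p.tors := by
  have : IsNoetherianRing Λ := IsNoetherianRing.of_finite k Λ
  refine le_antisymm (fun M hM => ?_) ?_
  · exact pureCogen_of_forall_finite_quotient k fun N hN => (p.tors_iff _).2
      ⟨Module.finitePresentation_of_finite Λ _, leftOrthogonal_of_surjective hM N.mkQ
        N.mkQ_surjective⟩
  · exact (isDefinable_leftOrthogonal k p.torsFree_le).pureCogen_le
      fun X hX => ((p.tors_iff X).1 hX).2

end FiniteDimensional

theorem mainTheorem6 (k : Type v) [Field k] (Λ : Type u) [Ring Λ] [Algebra k Λ]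
    [FiniteDimensional k Λ] :
    ∃ e : TorsionPairIn (fpModules Λ) ≃
        {P : TorsionPairIn (⊤ : ObjectProperty (ModuleCat.{u} Λ)) // IsDefinable P.tors},
      (∀ p : TorsionPairIn (fpModules Λ),
        (e p).1.tors = p.torsFree.leftOrthogonal ∧
        (e p).1.torsFree = p.torsFree.leftOrthogonal.rightOrthogonal ∧
        (e p).1.tors = pureCogen p.tors) ∧
      (∀ P : {P : TorsionPairIn (⊤ : ObjectProperty (ModuleCat.{u} Λ)) // IsDefinable P.tors},
        (e.symm P).tors = P.1.tors ⊓ fpModules Λ ∧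
        (e.symm P).torsFree = P.1.torsFree ⊓ fpModules Λ) := by
  have : IsNoetherianRing Λ := IsNoetherianRing.of_finite k Λ
  refine ⟨{
    toFun := fun p => ⟨torsionPairCogeneratedBy p.torsFree,
      isDefinable_leftOrthogonal k p.torsFree_le⟩
    invFun := fun P => P.1.restrictFP
    left_inv := fun p => ?_
    right_inv := fun P => ?_ }, fun p => ⟨rfl, rfl, p.leftOrthogonal_torsFree_eq_pureCogen k⟩,
    fun P => ⟨rfl, rfl⟩⟩
  · refine TorsionPairIn.ext_of_tors_eq (funext fun X => propext ?_)
    rw [p.tors_iff X]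
    exact and_comm
  · refine Subtype.ext (TorsionPairIn.ext_of_tors_eq (le_antisymm ?_ fun X hX => ?_))
    -- Only this inclusion uses definability.
    · refine (P.1.restrictFP.leftOrthogonal_torsFree_eq_pureCogen k).trans_le ?_
      exact P.2.pureCogen_le inf_le_left
    · exact fun Y f hY => P.1.hom_eq_zero X Y hX hY.1 f
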